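/- Let $\mathcal H$ be a complex Hilbert space (possibly infinite dimensional), with inner product linear in the first variable, and let $\mathcal B(\mathcal H)$ be the algebra of bounded operators on it. A continuous linear functional $\varphi$ on $\mathcal B(\mathcal H)$ is *normal* if $\varphi(x)=\operatorname{tr}(\Phi x)$ for all $x$, for some trace-class operator $\Phi$; the space of normal functionals is $\mathcal B(\mathcal H)_*$. A *state* is a positive linear functional of norm one. For $\xi,\eta\in\mathcal H$ put $\omega_{\xi,\eta}(x)=\langle x\xi,\eta\rangle$ and $\omega_\xi=\omega_{\xi,\xi}$. Let $V\subset\mathcal H$ be a set of unit vectors that is balanced ($\lambda\xi\in V$ whenever $\xi\in V$, $\lambda\in\mathbb C$, $|\lambda|=1$) and separates the points of $\mathcal H$ (if $\langle\xi,\eta\rangle=0$ for all $\eta\in V$, then $\xi=0$). Let $$K=\overline{\mathrm{co}}^{\|\cdot\|}\{\omega_{\xi,\eta}:\xi,\eta\in V\}\subset\mathcal B(\mathcal H)_*,\qquad \|x\|_K=\sup\{|\psi(x)|:\psi\in K\}\quad(x\in\mathcal B(\mathcal H)),$$ $$q_K(\psi)=\inf\{\alpha\ge 0:\psi\in\alpha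 K\}\in[0,\infty]\quad(\inf\emptyset=\infty),$$ $$E(\psi)=\sup\{|\psi(x)|: x\in\mathcal K(\mathcal H)+\mathbb C 1,\ \|x\|_K\le 1\}\in[0,\infty]\qquad(\psi\in\mathcal B(\mathcal H)_*),$$ where $\mathcal K(\mathcal H)$ denotes the compact operators. Then for every normal state $\varphi$ on $\mathcal B(\mathcal H)$ the following are equivalent: 1. $\varphi\in\overline{\mathrm{co}}^{\|\cdot\|}\{\omega_\xi:\xi\in V\}$; 2. $E(\varphi)=1$; 3. $q_K(\varphi)=1$. -/

import Mathlib

open scoped ENNReal NNReal ComplexOrder Pointwise InnerProductSpace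

noncomputable section

namespace Arveson

variable {H : Type*} [NormedAddCommGroup H] [InnerProductSpace ℂ H] [CompleteSpace H]

/-- An orthonormal basis of `H`, used to compute traces. The trace of a trace-class operator
does not depend on it. -/
def onb (H : Type*) [NormedAddCommGroup H] [InnerProductSpace ℂ H] [CompleteSpace H] :
    HilbertBasis (exists_hilbertBasis ℂ H).choose ℂ H :=
  (exists_hilbertBasis ℂ H).choose_spec.choose

/-- `T` is trace class: `∑ᵢ ⟨|T| eᵢ, eᵢ⟩ < ∞`, where `|T| = (T⋆T)^(1/2)`. -/
def IsTraceClass (T : H →L[ℂ] H) : Prop :=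
  Summable fun i => (⟪onb H i, CFC.abs T (onb H i)⟫_ℂ).re

/-- The trace `∑ᵢ ⟨T eᵢ, eᵢ⟩` (meaningful for trace-class operators). -/
def trace (T : H →L[ℂ] H) : ℂ :=
  ∑' i, ⟪onb H i, T (onb H i)⟫_ℂ

/-- A normal functional on `B(H)`: `φ(x) = tr(Φ x)` for some trace-class operator `Φ`. -/
def IsNormal (φ : (H →L[ℂ] H) →L[ℂ] ℂ) : Prop :=
  ∃ Φ : H →L[ℂ] H, IsTraceClass Φ ∧ ∀ x : H →L[ℂ] H, φ x = trace (Φ * x)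

/-- A state on `B(H)`: a positive linear functional of norm one. -/
def IsState (φ : (H →L[ℂ] H) →L[ℂ] ℂ) : Prop :=
  (∀ x : H →L[ℂ] H, x.IsPositive → 0 ≤ φ x) ∧ ‖φ‖ = 1

/-- The vector functional `ω_{ξ,η}(x) = ⟨x ξ, η⟩`, with the inner product linear in the first
variable; Mathlib's `⟪·, ·⟫_ℂ` is linear in the second one. -/
def vecFunctional (ξ η : H) : (H →L[ℂ] H) →L[ℂ] ℂ :=
  (innerSL ℂ η).comp (ContinuousLinearMap.apply ℂ H ξ)

/-- Closed under multiplication by complex numbers of modulus one. -/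
def IsCircleBalanced (V : Set H) : Prop :=
  ∀ ξ ∈ V, ∀ c : ℂ, ‖c‖ = 1 → c • ξ ∈ V

/-- `V` separates the points of `H`. -/
def Separates (V : Set H) : Prop :=
  ∀ ξ : H, (∀ η ∈ V, ⟪η, ξ⟫_ℂ = 0) → ξ = 0

/-- `K`, the norm-closed convex hull of `{ω_{ξ,η} : ξ, η ∈ V}`. The closure is taken in the dual
of `B(H)`; the space of normal functionals is norm closed there, so it is the same as the closure
in the predual. -/
def K (V : Set H) : Set ((H →L[ℂ] H) →L[ℂ] ℂ) :=
  closure (convexHull ℝ {ψ | ∃ ξ ∈ V, ∃ η ∈ V, ψ = vecFunctional ξ η})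

/-- The norm-closed convex hull of the vector states `ω_ξ = ω_{ξ,ξ}`, `ξ ∈ V`. -/
def separableStates (V : Set H) : Set ((H →L[ℂ] H) →L[ℂ] ℂ) :=
  closure (convexHull ℝ {ψ | ∃ ξ ∈ V, ψ = vecFunctional ξ ξ})

/-- `‖x‖_K = sup {|ψ(x)| : ψ ∈ K}`. -/
def normK (V : Set H) (x : H →L[ℂ] H) : ℝ≥0∞ :=
  ⨆ ψ ∈ K V, ‖ψ x‖ₑ

/-- The Minkowski functional `q_K(ψ) = inf {α ≥ 0 : ψ ∈ α K}`, equal to `∞` if there is no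
such `α`. -/
def qK (V : Set H) (ψ : (H →L[ℂ] H) →L[ℂ] ℂ) : ℝ≥0∞ :=
  ⨅ (α : ℝ≥0) (_ : ψ ∈ (α : ℝ) • K V), (α : ℝ≥0∞)

/-- The algebra `𝒜 = 𝒦(H) + ℂ 1` of compact operators plus scalars. -/
def compactPlusScalars (H : Type*) [NormedAddCommGroup H] [InnerProductSpace ℂ H] :
    Set (H →L[ℂ] H) :=
  {x | ∃ (k : H →L[ℂ] H) (c : ℂ), IsCompactOperator k ∧ x = k + c • (1 : H →L[ℂ] H)}

/-- `E(ψ) = sup {|ψ(x)| : x ∈ 𝒜, ‖x‖_K ≤ 1}`. -/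
def E (V : Set H) (ψ : (H →L[ℂ] H) →L[ℂ] ℂ) : ℝ≥0∞ :=
  ⨆ x ∈ {x : H →L[ℂ] H | x ∈ compactPlusScalars H ∧ normK V x ≤ 1}, ‖ψ x‖ₑ

end Arveson

end

namespace Arveson

open InnerProductSpace

set_option linter.unusedSectionVars false

variable {H : Type*} [NormedAddCommGroup H] [InnerProductSpace ℂ H] [CompleteSpace H]

/-! Since `1` lies in 𝒦(H) + ℂ1 with K-norm at most one, 1 ≤ E(φ) ≤ q_K(φ) (`one_le_E`, `E_le_qK`);
a separable state lies in K, so q_K(φ) ≤ 1. This gives 1 → 3 → 2.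

For 2 → 1, Hahn–Banach turns E(φ) ≤ 1 into approximation of φ, on finitely many elements of 𝒦(H) +
ℂ1, by convex combinations ψ of the ω_{ξ,η} (`exists_mem_convexHull_forall_norm_sub_lt`). With `1`
among these elements, ψ(1) is almost 1; as ‖η - ξ‖² = 2 - 2 Re⟨ξ,η⟩, each η may be replaced by ξ at
small cost in norm (`exists_mem_convexHull_norm_sub_sq_le`). Finally, states close to a normal state
on suitable finitely many operators are close in norm, because the normal state nearly lives on a
finite-rank corner (`exists_finset_norm_sub_lt`). -/

/-! ### Positive functionals on `B(H)` -/

/-- The Cauchy–Schwarz inequality for a positive functional. -/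
theorem norm_apply_star_mul_le {φ : (H →L[ℂ] H) →L[ℂ] ℂ}
    (hφ : ∀ x : H →L[ℂ] H, x.IsPositive → 0 ≤ φ x) (a b : H →L[ℂ] H) :
    ‖φ (star a * b)‖ ≤ √(φ (star a * a)).re * √(φ (star b * b)).re := by
  let f : (H →L[ℂ] H) →ₚ[ℂ] ℂ := PositiveLinearMap.mk₀ φ.toLinearMap
    fun x hx => hφ x ((ContinuousLinearMap.nonneg_iff_isPositive x).1 hx)
  exact norm_inner_le_norm (𝕜 := ℂ) (f.toPreGNS a) (f.toPreGNS b)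

theorem re_apply_star_mul_self_le {φ : (H →L[ℂ] H) →L[ℂ] ℂ}
    (hφ : ∀ x : H →L[ℂ] H, x.IsPositive → 0 ≤ φ x) (x : H →L[ℂ] H) :
    (φ (star x * x)).re ≤ (φ 1).re * ‖x‖ ^ 2 := by
  have h : star x * x ≤ algebraMap ℝ (H →L[ℂ] H) (‖x‖ ^ 2) :=
    CStarAlgebra.star_mul_le_algebraMap_norm_sq
  have h' := hφ _ ((ContinuousLinearMap.nonneg_iff_isPositive _).1 (sub_nonneg.2 h))
  rw [Algebra.algebraMap_eq_smul_one, map_sub, ← Complex.coe_smul, map_smul] at h'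
  have h'' := (Complex.nonneg_iff.1 h').1
  simp only [Complex.sub_re, smul_eq_mul, Complex.re_ofReal_mul] at h''
  linarith

theorem norm_apply_le {φ : (H →L[ℂ] H) →L[ℂ] ℂ}
    (hφ : ∀ x : H →L[ℂ] H, x.IsPositive → 0 ≤ φ x) (x : H →L[ℂ] H) :
    ‖φ x‖ ≤ (φ 1).re * ‖x‖ := by
  have h1 : 0 ≤ (φ 1).re := (Complex.nonneg_iff.1 (hφ 1 ContinuousLinearMap.isPositive_one)).1
  have h := norm_apply_star_mul_le hφ 1 x
  simp only [star_one, one_mul] at h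
  calc ‖φ x‖ ≤ √(φ 1).re * √(φ (star x * x)).re := h
    _ ≤ √(φ 1).re * √((φ 1).re * ‖x‖ ^ 2) := by
        gcongr; exact re_apply_star_mul_self_le hφ x
    _ = (φ 1).re * ‖x‖ := by
        rw [Real.sqrt_mul h1, Real.sqrt_sq (norm_nonneg x), ← mul_assoc, Real.mul_self_sqrt h1]

theorem norm_one_le : ‖(1 : H →L[ℂ] H)‖ ≤ 1 := ContinuousLinearMap.norm_id_le

theorem IsState.apply_one {φ : (H →L[ℂ] H) →L[ℂ] ℂ} (hφ : IsState φ) : φ 1 = 1 := by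
  have h0 := Complex.nonneg_iff.1 (hφ.1 1 ContinuousLinearMap.isPositive_one)
  have h1 : 1 ≤ (φ 1).re := hφ.2 ▸ φ.opNorm_le_bound h0.1 (norm_apply_le hφ.1)
  have h2 : (φ 1).re ≤ 1 := by
    have h3 := φ.le_opNorm 1
    rw [hφ.2, one_mul] at h3
    exact (Complex.re_le_norm _).trans (h3.trans norm_one_le)
  exact Complex.ext (le_antisymm h2 h1) h0.2.symm

/-- A unital positive functional is determined up to `2 √(1 - φ(p)) ‖x‖` by its compression to a
projection `p`. -/
theorem norm_apply_sub_compression_le {φ : (H →L[ℂ] H) →L[ℂ] ℂ}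
    (hφ : ∀ x : H →L[ℂ] H, x.IsPositive → 0 ≤ φ x) (h1 : φ 1 = 1)
    {p : H →L[ℂ] H} (hp : IsStarProjection p) (x : H →L[ℂ] H) :
    ‖φ x - φ (p * x * p)‖ ≤ 2 * √(1 - (φ p).re) * ‖x‖ := by
  have hq := hp.one_sub
  have hqq : star (1 - p) * (1 - p) = 1 - p := by
    rw [hq.isSelfAdjoint.star_eq]; exact hq.isIdempotentElem
  have hφq : (φ (1 - p)).re = 1 - (φ p).re := by simp [h1]
  have hpn : ‖p‖ ≤ 1 := hp.norm_le
  have hsq (y : H →L[ℂ] H) : √(φ (star y * y)).re ≤ ‖y‖ := by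
    refine Real.sqrt_le_iff.2 ⟨norm_nonneg y, ?_⟩
    simpa [h1] using re_apply_star_mul_self_le hφ y
  -- x - pxp = (1 - p)x + px(1 - p); Cauchy–Schwarz extracts a factor √φ(1 - p) from each term.
  have e : x - p * x * p = star (1 - p) * x + star (star x * p) * (1 - p) := by
    rw [hq.isSelfAdjoint.star_eq, star_mul, star_star, hp.isSelfAdjoint.star_eq]
    noncomm_ring
  have hA := norm_apply_star_mul_le hφ (1 - p) x
  have hB := norm_apply_star_mul_le hφ (star x * p) (1 - p)
  rw [hqq, hφq] at hA hB
  have hs := Real.sqrt_nonneg (1 - (φ p).re)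
  have hxp : ‖star x * p‖ ≤ ‖x‖ := by
    refine (norm_mul_le _ _).trans ?_
    rw [norm_star]
    exact mul_le_of_le_one_right (norm_nonneg x) hpn
  have hA' := hA.trans (mul_le_mul_of_nonneg_left (hsq x) hs)
  have hB' := hB.trans (mul_le_mul_of_nonneg_right ((hsq _).trans hxp) hs)
  rw [← map_sub, e, map_add]
  calc _ ≤ _ := norm_add_le _ _
    _ ≤ _ := add_le_add hA' hB'
    _ = _ := by ring

/-! ### Finite-dimensional compressions -/

/-- The projection onto the span of finitely many members of an orthonormal family. -/
noncomputable def finProj {ι : Type*} (e : ι → H) (F : Finset ι) : H →L[ℂ] H :=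
  ∑ i ∈ F, rankOne ℂ (e i) (e i)

theorem isStarProjection_finProj {ι : Type*} {e : ι → H} (he : Orthonormal ℂ e) (F : Finset ι) :
    IsStarProjection (finProj e F) := by
  classical
  refine ⟨?_, ?_⟩
  · simp only [IsIdempotentElem, finProj, Finset.sum_mul, Finset.mul_sum,
      ContinuousLinearMap.mul_def, rankOne_comp_rankOne, orthonormal_iff_ite.1 he]
    simp
  · simp only [IsSelfAdjoint, finProj, star_sum, ContinuousLinearMap.star_eq_adjoint,
      adjoint_rankOne]

/-- The corner is spanned by `F.card ^ 2` matrix units, so finitely many values control a functional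
on it. -/
theorem finProj_mul_mul_finProj {ι : Type*} (e : ι → H) (F : Finset ι) (x : H →L[ℂ] H) :
    finProj e F * x * finProj e F =
      ∑ i ∈ F, ∑ j ∈ F, ⟪e i, x (e j)⟫_ℂ • rankOne ℂ (e i) (e j) := by
  have h (i j) : rankOne ℂ (e i) (e i) * x * rankOne ℂ (e j) (e j) =
      ⟪e i, x (e j)⟫_ℂ • rankOne ℂ (e i) (e j) := by
    ext v
    simp [smul_smul, mul_comm]
  simp only [finProj, Finset.sum_mul, Finset.mul_sum, h]
  exact Finset.sum_comm

theorem isCompactOperator_rankOne (ξ η : H) :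
    IsCompactOperator (rankOne ℂ ξ η : H →L[ℂ] H) := by
  have h : IsCompactOperator (innerSL ℂ η : H →L[ℂ] ℂ) :=
    isCompactOperator_of_locallyCompactSpace_dom (innerSL ℂ η)
  exact h.clm_comp (ContinuousLinearMap.toSpanSingleton ℂ ξ)

/-- A normal state is almost concentrated on a finite-dimensional subspace. -/
theorem exists_re_apply_finProj {φ : (H →L[ℂ] H) →L[ℂ] ℂ} (hφ : IsState φ) (hn : IsNormal φ)
    {ε : ℝ} (hε : 0 < ε) : ∃ F, 1 - ε < (φ (finProj (onb H) F)).re := by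
  classical
  obtain ⟨Φ, -, hΦ⟩ := hn
  have h1 : ∑' i, ⟪onb H i, Φ (onb H i)⟫_ℂ = 1 := by
    have := hΦ 1
    rwa [hφ.apply_one, mul_one, trace, eq_comm] at this
  -- the series converges, since its sum is not zero
  have hs : Summable fun i => ⟪onb H i, Φ (onb H i)⟫_ℂ := by
    by_contra h
    rw [tsum_eq_zero_of_not_summable h] at h1
    exact zero_ne_one h1
  have hF (F) : φ (finProj (onb H) F) = ∑ i ∈ F, ⟪onb H i, Φ (onb H i)⟫_ℂ := by
    rw [hΦ, trace, tsum_eq_sum (s := F)]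
    · refine Finset.sum_congr rfl fun i hi => ?_
      simp [finProj, orthonormal_iff_ite.1 (onb H).orthonormal, hi]
    · intro i hi
      simp [finProj, orthonormal_iff_ite.1 (onb H).orthonormal, hi]
  have hlim := (Complex.continuous_re.tendsto _).comp (h1 ▸ hs.hasSum)
  have hlt : 1 - ε < (1 : ℂ).re := by simpa using hε
  obtain ⟨F, hF'⟩ := (hlim.eventually (lt_mem_nhds hlt)).exists
  exact ⟨F, by rw [hF]; exact hF'⟩

/-- Weak convergence of states on compact operators to a normal state implies norm convergence. -/
theorem exists_finset_norm_sub_lt {φ : (H →L[ℂ] H) →L[ℂ] ℂ} (hφ : IsState φ) (hn : IsNormal φ)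
    {ε : ℝ} (hε : 0 < ε) :
    ∃ s : Finset (H →L[ℂ] H), (∀ a ∈ s, a ∈ compactPlusScalars H) ∧ ∃ δ > 0,
      ∀ ψ : (H →L[ℂ] H) →L[ℂ] ℂ, (∀ x : H →L[ℂ] H, x.IsPositive → 0 ≤ ψ x) → ψ 1 = 1 →
        (∀ a ∈ s, ‖ψ a - φ a‖ < δ) → ‖ψ - φ‖ < ε := by
  classical
  -- The error is 2η for compressing ψ, 2η for compressing φ and η on the corner: 5η < ε.
  set η : ℝ := ε / 6 with hη
  have hη0 : 0 < η := by positivity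
  obtain ⟨F, hF⟩ := exists_re_apply_finProj hφ hn (ε := η ^ 2 / 2) (by positivity)
  set e := onb H
  have hp := isStarProjection_finProj e.orthonormal F
  set p := finProj e F with hpdef
  have hmem (i j) : rankOne ℂ (e i) (e j) ∈ compactPlusScalars H :=
    ⟨_, 0, isCompactOperator_rankOne (e i) (e j), by simp⟩
  have hpmem : p ∈ compactPlusScalars H := by
    refine ⟨p, 0, ?_, by simp⟩
    exact Submodule.sum_mem (compactOperator (RingHom.id ℂ) H H)
      (fun i _ => isCompactOperator_rankOne (e i) (e i))
  -- Closeness η²/2 at `p` keeps 1 - ψ(p) below η²; the second bound is summed over `F.card ^ 2`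
  -- matrix units, the `+ 1` covering empty `F`.
  refine ⟨insert p ((F ×ˢ F).image fun ij => rankOne ℂ (e ij.1) (e ij.2)), ?_,
    min (η ^ 2 / 2) (η / (F.card ^ 2 + 1)), by positivity, fun ψ hψ hψ1 h => ?_⟩
  · intro a ha
    rcases Finset.mem_insert.1 ha with rfl | ha
    · exact hpmem
    · obtain ⟨ij, -, rfl⟩ := Finset.mem_image.1 ha
      exact hmem _ _
  have hψp : 1 - η ^ 2 < (ψ p).re := by
    have h3 := (h p (Finset.mem_insert_self _ _)).trans_le (min_le_left _ _)
    have h4 := (abs_lt.1 ((Complex.abs_re_le_norm _).trans_lt h3)).1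
    rw [Complex.sub_re] at h4
    linarith
  have hsψ : √(1 - (ψ p).re) ≤ η := Real.sqrt_le_iff.2 ⟨hη0.le, by linarith⟩
  have hsφ : √(1 - (φ p).re) ≤ η :=
    Real.sqrt_le_iff.2 ⟨hη0.le, by linarith [sq_nonneg η]⟩
  have hij (x : H →L[ℂ] H) : ‖ψ (p * x * p) - φ (p * x * p)‖ ≤ η * ‖x‖ := by
    rw [← sub_apply, hpdef, finProj_mul_mul_finProj]
    simp only [map_sum, map_smul]
    have hterm : ∀ i ∈ F, ∀ j ∈ F, ‖⟪e i, x (e j)⟫_ℂ • (ψ - φ) (rankOne ℂ (e i) (e j))‖ ≤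
        ‖x‖ * (η / (F.card ^ 2 + 1)) := by
      intro i hi j hj
      rw [norm_smul]
      refine mul_le_mul ?_ ?_ (norm_nonneg _) (norm_nonneg _)
      · refine (norm_inner_le_norm _ _).trans ?_
        rw [e.orthonormal.1 i, one_mul]
        simpa [e.orthonormal.1 j] using x.le_opNorm (e j)
      · refine ((h _ (Finset.mem_insert_of_mem (Finset.mem_image.2
          ⟨(i, j), Finset.mem_product.2 ⟨hi, hj⟩, rfl⟩))).trans_le (min_le_right _ _)).le
    refine (norm_sum_le_of_le F fun i hi => norm_sum_le_of_le F (hterm i hi)).trans ?_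
    simp only [Finset.sum_const, nsmul_eq_mul]
    have h5 : (F.card : ℝ) ^ 2 / (F.card ^ 2 + 1) ≤ 1 := by
      rw [div_le_one (by positivity)]; linarith
    calc _ = ((F.card : ℝ) ^ 2 / (F.card ^ 2 + 1)) * (η * ‖x‖) := by ring
      _ ≤ 1 * (η * ‖x‖) := by gcongr
      _ = _ := one_mul _
  refine lt_of_le_of_lt ((ψ - φ).opNorm_le_bound (M := 5 * η) (by positivity) fun x => ?_)
    (by linarith)
  have hA := norm_apply_sub_compression_le hψ hψ1 hp x
  have hB := norm_apply_sub_compression_le hφ.1 hφ.apply_one hp x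
  rw [norm_sub_rev] at hB
  have hA' : 2 * √(1 - (ψ p).re) * ‖x‖ ≤ 2 * η * ‖x‖ := by gcongr
  have hB' : 2 * √(1 - (φ p).re) * ‖x‖ ≤ 2 * η * ‖x‖ := by gcongr
  have e1 : (ψ - φ) x = (ψ x - ψ (p * x * p)) + (ψ (p * x * p) - φ (p * x * p)) +
      (φ (p * x * p) - φ x) := by
    rw [sub_apply]; ring
  rw [e1]
  refine (norm_add₃_le).trans ?_
  linarith [hij x]

/-! ### Vector functionals -/

@[simp]
theorem vecFunctional_apply (ξ η : H) (x : H →L[ℂ] H) : vecFunctional ξ η x = ⟪η, x ξ⟫_ℂ := rfl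

theorem norm_vecFunctional_le (ξ η : H) : ‖vecFunctional ξ η‖ ≤ ‖ξ‖ * ‖η‖ := by
  refine ContinuousLinearMap.opNorm_le_bound _ (by positivity) fun x => ?_
  rw [vecFunctional_apply]
  calc _ ≤ ‖η‖ * ‖x ξ‖ := norm_inner_le_norm _ _
    _ ≤ ‖η‖ * (‖x‖ * ‖ξ‖) := by gcongr; exact x.le_opNorm ξ
    _ = _ := by ring

theorem vecFunctional_sub_right (ξ η ζ : H) :
    vecFunctional ξ (η - ζ) = vecFunctional ξ η - vecFunctional ξ ζ := by
  ext x; simp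

theorem pos_and_apply_one_of_mem_convexHull {V : Set H} (hV : ∀ ξ ∈ V, ‖ξ‖ = 1)
    {ψ : (H →L[ℂ] H) →L[ℂ] ℂ}
    (hψ : ψ ∈ convexHull ℝ {ψ | ∃ ξ ∈ V, ψ = vecFunctional ξ ξ}) :
    (∀ x : H →L[ℂ] H, x.IsPositive → 0 ≤ ψ x) ∧ ψ 1 = 1 := by
  refine convexHull_min (t := {ψ : (H →L[ℂ] H) →L[ℂ] ℂ |
    (∀ x : H →L[ℂ] H, x.IsPositive → 0 ≤ ψ x) ∧ ψ 1 = 1}) ?_ ?_ hψ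
  · rintro _ ⟨ξ, hξ, rfl⟩
    refine ⟨fun x hx => hx.inner_nonneg_right ξ, ?_⟩
    simp [hV ξ hξ]
  · rintro ψ₁ h₁ ψ₂ h₂ a b ha hb hab
    refine ⟨fun x hx => ?_, ?_⟩
    · exact add_nonneg (smul_nonneg ha (h₁.1 x hx)) (smul_nonneg hb (h₂.1 x hx))
    · simp only [add_apply, smul_apply, h₁.2, h₂.2,
        ← add_smul, hab, one_smul]

/-- A convex combination of functionals `ω_{ξ,η}` that is almost unital is close to a convex
combination of states `ω_ξ`. -/
theorem exists_mem_convexHull_norm_sub_sq_le {V : Set H} (hV : ∀ ξ ∈ V, ‖ξ‖ = 1)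
    {ψ : (H →L[ℂ] H) →L[ℂ] ℂ}
    (hψ : ψ ∈ convexHull ℝ {ψ | ∃ ξ ∈ V, ∃ η ∈ V, ψ = vecFunctional ξ η}) :
    ∃ ψ' ∈ convexHull ℝ {ψ | ∃ ξ ∈ V, ψ = vecFunctional ξ ξ},
      ‖ψ - ψ'‖ ^ 2 ≤ 2 * (1 - (ψ 1).re) := by
  -- With the norm squared, the left side is convex and the right side affine, so the bound passes
  -- to convex combinations.
  refine convexHull_min (t := {ψ : (H →L[ℂ] H) →L[ℂ] ℂ |
    ∃ ψ' ∈ convexHull ℝ {ψ | ∃ ξ ∈ V, ψ = vecFunctional ξ ξ},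
      ‖ψ - ψ'‖ ^ 2 ≤ 2 * (1 - (ψ 1).re)}) ?_ ?_ hψ
  · rintro _ ⟨ξ, hξ, η, hη, rfl⟩
    refine ⟨_, subset_convexHull ℝ _ ⟨ξ, hξ, rfl⟩, ?_⟩
    rw [← vecFunctional_sub_right]
    have h := norm_vecFunctional_le ξ (η - ξ)
    rw [hV ξ hξ, one_mul] at h
    have h2 := norm_sub_sq (𝕜 := ℂ) η ξ
    rw [hV ξ hξ, hV η hη] at h2
    calc _ ≤ ‖η - ξ‖ ^ 2 := by gcongr
      _ = _ := by rw [h2]; simp; ring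
  · rintro ψ₁ ⟨χ₁, hχ₁, h₁⟩ ψ₂ ⟨χ₂, hχ₂, h₂⟩ a b ha hb hab
    refine ⟨a • χ₁ + b • χ₂, convex_convexHull ℝ _ hχ₁ hχ₂ ha hb hab, ?_⟩
    have e : a • ψ₁ + b • ψ₂ - (a • χ₁ + b • χ₂) = a • (ψ₁ - χ₁) + b • (ψ₂ - χ₂) := by module
    have hn : ‖a • (ψ₁ - χ₁) + b • (ψ₂ - χ₂)‖ ≤ a * ‖ψ₁ - χ₁‖ + b * ‖ψ₂ - χ₂‖ := by
      refine (norm_add_le _ _).trans_eq ?_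
      rw [norm_smul, norm_smul, Real.norm_of_nonneg ha, Real.norm_of_nonneg hb]
    have hc := (convexOn_pow 2).2 (Set.mem_Ici.2 (norm_nonneg (ψ₁ - χ₁)))
      (Set.mem_Ici.2 (norm_nonneg (ψ₂ - χ₂))) ha hb hab
    simp only [smul_eq_mul] at hc
    rw [e]
    calc _ ≤ (a * ‖ψ₁ - χ₁‖ + b * ‖ψ₂ - χ₂‖) ^ 2 := by gcongr
      _ ≤ _ := hc
      _ ≤ a * (2 * (1 - (ψ₁ 1).re)) + b * (2 * (1 - (ψ₂ 1).re)) := by gcongr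
      _ = 2 * ((a + b) - (a * (ψ₁ 1).re + b * (ψ₂ 1).re)) := by ring
      _ = _ := by rw [hab]; simp

/-! ### The body `K` and the associated norms -/

theorem norm_le_one_of_mem_K {V : Set H} (hV : ∀ ξ ∈ V, ‖ξ‖ = 1) {ψ : (H →L[ℂ] H) →L[ℂ] ℂ}
    (hψ : ψ ∈ K V) : ‖ψ‖ ≤ 1 := by
  have h : K V ⊆ Metric.closedBall 0 1 := by
    refine closure_minimal (convexHull_min ?_ (convex_closedBall 0 1)) Metric.isClosed_closedBall
    rintro _ ⟨ξ, hξ, η, hη, rfl⟩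
    simpa [hV ξ hξ, hV η hη] using norm_vecFunctional_le ξ η
  simpa using h hψ

theorem separableStates_subset_K (V : Set H) : separableStates V ⊆ K V :=
  closure_mono <| convexHull_mono fun _ ⟨ξ, hξ, h⟩ => ⟨ξ, hξ, ξ, hξ, h⟩

theorem enorm_apply_le_mul_normK {V : Set H} {ψ : (H →L[ℂ] H) →L[ℂ] ℂ} {α : ℝ≥0}
    (hψ : ψ ∈ (α : ℝ) • K V) (x : H →L[ℂ] H) : ‖ψ x‖ₑ ≤ α * normK V x := by
  obtain ⟨χ, hχ, rfl⟩ := hψ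
  have h : ‖χ x‖ₑ ≤ normK V x := le_iSup₂ (f := fun ψ (_ : ψ ∈ K V) => ‖ψ x‖ₑ) χ hχ
  have e : ((α : ℝ) • χ) x = (α : ℝ) • χ x := rfl
  simp only [e, enorm_smul]
  gcongr
  simp

theorem E_le_qK (V : Set H) (ψ : (H →L[ℂ] H) →L[ℂ] ℂ) : E V ψ ≤ qK V ψ := by
  refine le_iInf₂ fun α hα => iSup₂_le fun x hx => ?_
  calc _ ≤ α * normK V x := enorm_apply_le_mul_normK hα x
    _ ≤ α * 1 := by gcongr; exact hx.2
    _ = α := mul_one _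

/-- The test element is the identity, available because scalars are adjoined to the compact
operators. -/
theorem one_le_E {V : Set H} (hV : ∀ ξ ∈ V, ‖ξ‖ = 1) {φ : (H →L[ℂ] H) →L[ℂ] ℂ}
    (hφ : φ 1 = 1) : 1 ≤ E V φ := by
  have h1 : normK V 1 ≤ 1 := by
    refine iSup₂_le fun ψ hψ => ?_
    rw [← ofReal_norm, ← ENNReal.ofReal_one]
    refine ENNReal.ofReal_le_ofReal ((ψ.le_opNorm 1).trans ?_)
    exact mul_le_one₀ (norm_le_one_of_mem_K hV hψ) (norm_nonneg _) norm_one_le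
  have h0 : (1 : H →L[ℂ] H) ∈ compactPlusScalars H := ⟨0, 1, isCompactOperator_zero, by simp⟩
  refine le_trans ?_ (le_iSup₂ (f := fun x (_ : x ∈ {x : H →L[ℂ] H |
    x ∈ compactPlusScalars H ∧ normK V x ≤ 1}) => ‖φ x‖ₑ) 1 ⟨h0, h1⟩)
  simp [hφ]

theorem smul_mem_compactPlusScalars {x : H →L[ℂ] H} (c : ℂ) (hx : x ∈ compactPlusScalars H) :
    c • x ∈ compactPlusScalars H := by
  obtain ⟨k, d, hk, rfl⟩ := hx
  exact ⟨c • k, c * d, hk.smul c, by rw [smul_add, smul_smul]⟩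

theorem sum_mem_compactPlusScalars {ι : Type*} (s : Finset ι) {x : ι → H →L[ℂ] H}
    (hx : ∀ i ∈ s, x i ∈ compactPlusScalars H) : ∑ i ∈ s, x i ∈ compactPlusScalars H := by
  classical
  induction s using Finset.induction_on with
  | empty => exact ⟨0, 0, isCompactOperator_zero, by simp⟩
  | insert i s hi ih =>
    rw [Finset.sum_insert hi]
    obtain ⟨k, c, hk, h1⟩ := hx i (Finset.mem_insert_self i s)
    obtain ⟨l, d, hl, h2⟩ := ih fun j hj => hx j (Finset.mem_insert_of_mem hj)
    exact ⟨k + l, c + d, hk.add hl, by rw [h1, h2]; module⟩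

/-- If `E(φ) ≤ 1`, then `‖x‖_K` dominates `|φ(x)|` on compact operators plus scalars. -/
theorem norm_apply_le_of_normK_le {V : Set H} {φ : (H →L[ℂ] H) →L[ℂ] ℂ} (hE : E V φ ≤ 1)
    {x : H →L[ℂ] H} (hx : x ∈ compactPlusScalars H) {r : ℝ} (hr : 0 < r)
    (hxr : normK V x ≤ ENNReal.ofReal r) : ‖φ x‖ ≤ r := by
  have hc : ‖((r⁻¹ : ℝ) : ℂ)‖ₑ = ENNReal.ofReal r⁻¹ := by
    rw [← ofReal_norm, Complex.norm_real, Real.norm_of_nonneg (by positivity)]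
  have h1 : normK V (((r⁻¹ : ℝ) : ℂ) • x) ≤ 1 := by
    refine iSup₂_le fun ψ hψ => ?_
    rw [map_smul, enorm_smul, hc]
    calc _ ≤ ENNReal.ofReal r⁻¹ * ENNReal.ofReal r := by
          gcongr
          exact (le_iSup₂ (f := fun ψ (_ : ψ ∈ K V) => ‖ψ x‖ₑ) ψ hψ).trans hxr
      _ = 1 := by
          rw [← ENNReal.ofReal_mul (by positivity), inv_mul_cancel₀ hr.ne', ENNReal.ofReal_one]
  have h2 := (le_iSup₂ (f := fun x (_ : x ∈ {x : H →L[ℂ] H |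
    x ∈ compactPlusScalars H ∧ normK V x ≤ 1}) => ‖φ x‖ₑ) _
    ⟨smul_mem_compactPlusScalars _ hx, h1⟩).trans hE
  simp only [map_smul, enorm_smul, hc] at h2
  rw [← ofReal_norm, ← ENNReal.ofReal_mul (by positivity), ENNReal.ofReal_le_one,
    inv_mul_le_iff₀ hr, mul_one] at h2
  exact h2

/-- For circle-balanced `V`, a bound on `Re ω_{ξ,η}(x)` for all `ξ, η ∈ V` bounds `‖x‖_K`. -/
theorem normK_le_of_re_le {V : Set H} (hV : IsCircleBalanced V) {x : H →L[ℂ] H} {r : ℝ}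
    (h : ∀ ξ ∈ V, ∀ η ∈ V, (vecFunctional ξ η x).re ≤ r) : normK V x ≤ ENNReal.ofReal r := by
  have hK : K V ⊆ {ψ | ‖ψ x‖ ≤ r} := by
    refine closure_minimal (convexHull_min ?_ ?_)
      (isClosed_le (by fun_prop) continuous_const)
    · rintro _ ⟨ξ, hξ, η, hη, rfl⟩
      -- Rotating ξ by the conjugate phase makes the value equal to its modulus.
      obtain ⟨c, hc, hcz⟩ := Complex.exists_norm_mul_eq_self (vecFunctional ξ η x)
      have hc' := h ((starRingEnd ℂ c) • ξ) (hV ξ hξ _ (by simpa using hc)) η hη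
      have e : vecFunctional ((starRingEnd ℂ c) • ξ) η x = ‖vecFunctional ξ η x‖ := by
        have hcc : starRingEnd ℂ c * c = 1 := by
          rw [mul_comm, Complex.mul_conj, Complex.normSq_eq_norm_sq, hc]; simp
        have : vecFunctional ((starRingEnd ℂ c) • ξ) η x =
            starRingEnd ℂ c * vecFunctional ξ η x := by simp
        rw [this]
        nth_rewrite 1 [← hcz]
        rw [← mul_assoc, hcc, one_mul]
      rw [e, Complex.ofReal_re] at hc'
      exact hc'
    · intro ψ₁ h₁ ψ₂ h₂ a b ha hb hab
      have h3 := convex_closedBall (0 : ℂ) r (mem_closedBall_zero_iff.2 h₁)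
        (mem_closedBall_zero_iff.2 h₂) ha hb hab
      exact mem_closedBall_zero_iff.1 h3
  refine iSup₂_le fun ψ hψ => ?_
  rw [← ofReal_norm]
  exact ENNReal.ofReal_le_ofReal (hK hψ)

/-- If `E(φ) ≤ 1`, then on finitely many compact operators plus scalars `φ` is approximated by
convex combinations of the functionals `ω_{ξ,η}`. -/
theorem exists_mem_convexHull_forall_norm_sub_lt {V : Set H} (hV : IsCircleBalanced V)
    (hne : V.Nonempty) {φ : (H →L[ℂ] H) →L[ℂ] ℂ} (hE : E V φ ≤ 1) (s : Finset (H →L[ℂ] H))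
    (hs : ∀ a ∈ s, a ∈ compactPlusScalars H) {δ : ℝ} (hδ : 0 < δ) :
    ∃ ψ ∈ convexHull ℝ {ψ | ∃ ξ ∈ V, ∃ η ∈ V, ψ = vecFunctional ξ η},
      ∀ a ∈ s, ‖ψ a - φ a‖ < δ := by
  classical
  let L : ((H →L[ℂ] H) →L[ℂ] ℂ) →ₗ[ℝ] (s → ℂ) :=
    { toFun := fun ψ a => ψ a
      map_add' := fun _ _ => rfl
      map_smul' := fun _ _ => rfl }
  set C := convexHull ℝ {ψ : (H →L[ℂ] H) →L[ℂ] ℂ | ∃ ξ ∈ V, ∃ η ∈ V, ψ = vecFunctional ξ η}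
    with hC
  by_cases hmem : L φ ∈ closure (L '' C)
  · obtain ⟨_, ⟨ψ, hψ, rfl⟩, hd⟩ := Metric.mem_closure_iff.1 hmem δ hδ
    refine ⟨ψ, hψ, fun a ha => ?_⟩
    have := (dist_pi_lt_iff hδ).1 hd ⟨a, ha⟩
    rwa [dist_comm, dist_eq_norm] at this
  exfalso
  obtain ⟨f, u, hfu, hu⟩ := RCLike.geometric_hahn_banach_closed_point (𝕜 := ℂ)
    ((convex_convexHull ℝ _).linear_image L).closure isClosed_closure hmem
  -- The separating functional on ℂ^s is evaluation at a combination `x` of elements of `s`.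
  let x : H →L[ℂ] H := ∑ a : s, f (Pi.single a 1) • (a : H →L[ℂ] H)
  have hfx (ψ : (H →L[ℂ] H) →L[ℂ] ℂ) : f (L ψ) = ψ x := by
    conv_lhs => rw [pi_eq_sum_univ' (L ψ)]
    simp only [x, map_sum, map_smul, smul_eq_mul]
    refine Finset.sum_congr rfl fun a _ => ?_
    rw [mul_comm]
    congr 2
  have hx : x ∈ compactPlusScalars H :=
    sum_mem_compactPlusScalars _ fun a _ => smul_mem_compactPlusScalars _ (hs a a.2)
  have hre : ∀ ξ ∈ V, ∀ η ∈ V, (vecFunctional ξ η x).re ≤ u := by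
    intro ξ hξ η hη
    rw [← hfx]
    exact (hfu _ (subset_closure ⟨_, subset_convexHull ℝ _ ⟨ξ, hξ, η, hη, rfl⟩, rfl⟩)).le
  have hu0 : 0 ≤ u := by
    obtain ⟨ξ, hξ⟩ := hne
    have h1 := hre ξ hξ ξ hξ
    have h2 := hre (-ξ) (by simpa using hV ξ hξ (-1) (by simp)) ξ hξ
    simp only [vecFunctional_apply, map_neg, inner_neg_right, Complex.neg_re] at h1 h2
    linarith
  rw [hfx] at hu
  change u < (φ x).re at hu
  have hnK := normK_le_of_re_le hV hre
  -- `u` may be zero, so the midpoint of `u` and Re φ(x) serves as a positive radius still below Re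
  -- φ(x).
  have h3 := norm_apply_le_of_normK_le hE hx (r := (u + (φ x).re) / 2) (by linarith)
    (hnK.trans (ENNReal.ofReal_le_ofReal (by linarith)))
  linarith [Complex.re_le_norm (φ x)]

/-! ### From E(φ) ≤ 1 to norm approximation by separable states -/

theorem mem_separableStates_of_E_le_one {V : Set H} (hV_unit : ∀ ξ ∈ V, ‖ξ‖ = 1)
    (hV_bal : IsCircleBalanced V) (hne : V.Nonempty) {φ : (H →L[ℂ] H) →L[ℂ] ℂ}
    (hφ : IsState φ) (hn : IsNormal φ) (hE : E V φ ≤ 1) : φ ∈ separableStates V := by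
  classical
  refine Metric.mem_closure_iff.2 fun ε hε => ?_
  obtain ⟨s, hs, δ, hδ, h⟩ := exists_finset_norm_sub_lt hφ hn hε
  obtain ⟨M, hM0, hM⟩ : ∃ M : ℝ, 0 < M ∧ ∀ a ∈ s, ‖a‖ ≤ M := by
    refine ⟨∑ a ∈ s, ‖a‖ + 1, by positivity, fun a ha => ?_⟩
    have := Finset.single_le_sum (f := fun a : H →L[ℂ] H => ‖a‖) (fun _ _ => norm_nonneg _) ha
    linarith
  set κ := δ / (2 * M)
  have hκ : 0 < κ := by positivity
  have h1mem : (1 : H →L[ℂ] H) ∈ compactPlusScalars H := ⟨0, 1, isCompactOperator_zero, by simp⟩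
  -- Tolerance κ²/2 at `1` yields ‖ψ - χ‖ ≤ κ, which costs at most κM = δ/2 on `s`; the other δ/2 is
  -- for ψ against φ.
  obtain ⟨ψ, hψ, hψs⟩ := exists_mem_convexHull_forall_norm_sub_lt hV_bal hne hE (insert 1 s)
    (by simpa [h1mem] using hs) (δ := min (δ / 2) (κ ^ 2 / 2)) (by positivity)
  obtain ⟨χ, hχ, hψχ⟩ := exists_mem_convexHull_norm_sub_sq_le hV_unit hψ
  have hκ' : ‖ψ - χ‖ ≤ κ := by
    have h3 := (hψs 1 (Finset.mem_insert_self _ _)).trans_le (min_le_right _ _)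
    have h4 := (abs_lt.1 ((Complex.abs_re_le_norm _).trans_lt h3)).1
    rw [hφ.apply_one, Complex.sub_re, Complex.one_re] at h4
    exact (sq_le_sq₀ (norm_nonneg _) hκ.le).1 (by linarith)
  obtain ⟨hχpos, hχ1⟩ := pos_and_apply_one_of_mem_convexHull hV_unit hχ
  refine ⟨χ, hχ, ?_⟩
  rw [dist_comm, dist_eq_norm]
  refine h χ hχpos hχ1 fun a ha => ?_
  have h5 := (hψs a (Finset.mem_insert_of_mem ha)).trans_le (min_le_left _ _)
  have h6 : ‖χ a - ψ a‖ ≤ δ / 2 := by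
    rw [norm_sub_rev]
    calc _ ≤ ‖ψ - χ‖ * ‖a‖ := (ψ - χ).le_opNorm a
      _ ≤ κ * M := by gcongr; exact hM a ha
      _ = δ / 2 := by simp only [κ]; field_simp
  calc _ ≤ ‖χ a - ψ a‖ + ‖ψ a - φ a‖ := norm_sub_le_norm_sub_add_norm_sub _ _ _
    _ < δ := by linarith

theorem Separates.nonempty {V : Set H} (hV : Separates V) [Nontrivial H] : V.Nonempty := by
  by_contra h
  rw [Set.not_nonempty_iff_eq_empty] at h
  obtain ⟨ξ, hξ⟩ := exists_ne (0 : H)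
  exact hξ (hV ξ (by simp [h]))

theorem IsState.nontrivial {φ : (H →L[ℂ] H) →L[ℂ] ℂ} (hφ : IsState φ) : Nontrivial H := by
  by_contra h
  rw [not_nontrivial_iff_subsingleton] at h
  have h1 := hφ.apply_one
  rw [Subsingleton.elim (1 : H →L[ℂ] H) 0, map_zero] at h1
  exact zero_ne_one h1

end Arveson

theorem theorem2 {H : Type*} [NormedAddCommGroup H] [InnerProductSpace ℂ H] [CompleteSpace H]
    (V : Set H) (hV_unit : ∀ ξ ∈ V, ‖ξ‖ = 1) (hV_bal : Arveson.IsCircleBalanced V)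
    (hV_sep : Arveson.Separates V)
    (φ : (H →L[ℂ] H) →L[ℂ] ℂ) (hφ_state : Arveson.IsState φ) (hφ_normal : Arveson.IsNormal φ) :
    List.TFAE [φ ∈ Arveson.separableStates V, Arveson.E V φ = 1, Arveson.qK V φ = 1] := by
  have hE := Arveson.one_le_E hV_unit hφ_state.apply_one
  have hEq := Arveson.E_le_qK V φ
  tfae_have 1 → 3 := fun h =>
    le_antisymm (iInf₂_le_of_le 1 (by simpa using Arveson.separableStates_subset_K V h) (by simp))
      (hE.trans hEq)
  tfae_have 3 → 2 := fun h => le_antisymm (h ▸ hEq) hE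
  tfae_have 2 → 1 := fun h =>
    haveI := hφ_state.nontrivial
    Arveson.mem_separableStates_of_E_le_one hV_unit hV_bal hV_sep.nonempty hφ_state hφ_normal h.le
  tfae_finish
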